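/- Let $D$ be a diagram of an oriented virtual knot: a plane $4$-valent graph, traversed by one oriented closed curve going straight through every vertex (the crossingless circle is allowed), each vertex being marked as a virtual crossing or as a classical crossing with over/under information. Let $G=G(D)$ be its Gauss diagram, regarded as a graph: its vertices are the ends of the chords, and its edges are the chords $c\in Ch(G)$ (one for each classical crossing, oriented from the over-crossing to the under-crossing) together with the edges of the oriented core circle $CC(G)$, which correspond to the long arcs of $D$ (arcs between consecutive classical crossings, possibly passing through virtual crossings; if there is no classical crossing, $CC(G)$ is one closed edge without vertices, on which every coboundary vanishes). Every element of $C^1(G,\mathbb Z)$ is a cocycle, and $H^1(G,\mathbb Z)=C^1(G,\mathbb Z)/\delta C^0(G,\mathbb Z)$. The virtual index cocycle $vi_D\in C^1(G,\mathbb Z)$ is $0$ on every chord, and its value on a long arc is the sum, over the passages of the arc through virtual crossings, of $+1$ if the other strand crosses the arc from right to left and $-1$ if it crosses from left to right. The index class is $\iota_G=[vi_D]\in H^1(G,\mathbb Z)$. For a classical crossing $c$, the oriented smoothing at $c$ splits $D$ into the left half $D^l_c$ and the right half $D^r_c$. The positive half $D^+_c$ is $D^l_c$ if $c$ is a positive crossing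 (the under-strand crosses the over-strand from right to left) and $D^r_c$ if $c$ is negative. The index $Ind_D(c)$ is the sum, over the passages of $D^+_c$ through classical crossings other than $c$, of $+1$ if the other strand crosses from left to right and $-1$ if it crosses from right to left. **Proposition.** There is a unique cocycle $i^{ch}_G\in C^1(G,\mathbb Z)$ such that $[i^{ch}_G]=\iota_G$ and $i^{ch}_G|_{CC(G)}\equiv 0$. Moreover, $i^{ch}_G(c)=Ind_D(c)$ for every chord $c\in Ch(G)$. -/

import Mathlib

/-!
# Virtual knot diagrams, their Gauss diagrams and the index class

A virtual knot diagram is a plane 4-valent graph whose vertices are classical or virtual crossings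
and which is traversed by one closed curve.  It is encoded as a combinatorial plane map.  The
points `0, 1, …, n - 1 : ZMod n` are the successive points marked on the oriented curve.  Each of
them is a passage of the curve through a crossing (so that every crossing gives two points), or a
marker, which is an auxiliary 2-valent vertex on the curve.  Markers play no role in any
construction below; they let the crossingless circle be given by a curve with one marked point.
-/

/-- The nature of a marked point of the curve: the upper or the lower passage of a classical
crossing, a passage of a virtual crossing, or an auxiliary 2-valent vertex. -/
inductive PointKind where
  | over
  | under
  | virt
  | marker
  deriving DecidableEq

/-- A closed oriented generic curve with classical and virtual crossings on a closed oriented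
surface, as a combinatorial map (the surface is obtained by gluing a disc to each face). -/
structure CurveDiagram (n : ℕ) [NeZero n] where
  /-- The nature of each marked point. -/
  kind : ZMod n → PointKind
  /-- The other passage through the same crossing; a marker is its own partner. -/
  opp : ZMod n → ZMod n
  opp_opp : ∀ p, opp (opp p) = p
  opp_eq_self_iff : ∀ p, opp p = p ↔ kind p = PointKind.marker
  over_iff_under : ∀ p, kind p = PointKind.over ↔ kind (opp p) = PointKind.under
  /-- At a passage `p` of a crossing, `toLeft p = true` if the other strand crosses the strand
  through `p` from its right to its left, and `toLeft p = false` if it crosses from left to right.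
  The value at a marker is irrelevant. -/
  toLeft : ZMod n → Bool
  toLeft_opp : ∀ p, kind p ≠ PointKind.marker → toLeft (opp p) = !toLeft p

namespace CurveDiagram

variable {n : ℕ} [NeZero n] (D : CurveDiagram n)

/-- The next half-edge counterclockwise around a vertex.  The half-edge `(p, true)` leaves the
point `p` along the orientation of the curve and `(p, false)` arrives at `p`.  If the other strand
`q = opp p` crosses from right to left, the counterclockwise order is
`(p, true), (q, true), (p, false), (q, false)`. -/
def rot (h : ZMod n × Bool) : ZMod n × Bool :=
  if D.kind h.1 = PointKind.marker then (h.1, !h.2)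
  else (D.opp h.1, if D.toLeft h.1 then h.2 else !h.2)

/-- The other half of the edge to which a half-edge belongs. The edges of the map join the
successive points `p` and `p + 1`. -/
def otherHalf (h : ZMod n × Bool) : ZMod n × Bool :=
  if h.2 then (h.1 + 1, false) else (h.1 - 1, true)

/-- The vertices of the map: the crossings and the markers. -/
def MapVertex : Type := Quot fun p q : ZMod n => q = D.opp p

/-- The faces of the map: the orbits of the permutation `rot ∘ otherHalf` of the half-edges. -/
def MapFace : Type := Quot fun h k : ZMod n × Bool => k = D.rot (otherHalf h)

/-- The diagram is drawn in the plane (equivalently, in the sphere): the connected map has Euler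
characteristic `V - E + F = 2`.  It has `n` edges. -/
def IsPlanar : Prop :=
  (Nat.card D.MapVertex : ℤ) - (n : ℤ) + (Nat.card D.MapFace : ℤ) = 2

end CurveDiagram

/-- A diagram of an oriented virtual knot. -/
structure VirtualKnotDiagram (n : ℕ) [NeZero n] extends CurveDiagram n where
  planar : toCurveDiagram.IsPlanar

namespace VirtualKnotDiagram

variable {n : ℕ} [NeZero n] (D : VirtualKnotDiagram n)

/-- The point `p` is a passage of a classical crossing. -/
abbrev IsClassical (p : ZMod n) : Prop :=
  D.kind p = PointKind.over ∨ D.kind p = PointKind.under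

/-- `1` if the other strand crosses the strand through `p` from right to left, `-1` if it crosses
from left to right. -/
def crossSign (p : ZMod n) : ℤ := if D.toLeft p then 1 else -1

/-! ### The Gauss diagram as a graph -/

/-- The chords of the Gauss diagram, i.e. the classical crossings of `D`; a crossing is given by
its upper passage.  A chord is oriented from its upper to its lower passage. -/
def Chord : Type := {p : ZMod n // D.kind p = PointKind.over}

/-- The vertices of the Gauss diagram on its core circle: the ends of the chords. -/
def GaussVertex : Type := {p : ZMod n // D.IsClassical p}

instance : Fintype D.GaussVertex :=
  inferInstanceAs (Fintype {p : ZMod n // D.IsClassical p})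

/-- The long arcs of `D`, i.e. the edges of the core circle of the Gauss diagram (and the edges of
the covering graph): the edge `p` of the curve, from the point `p` to the point `p + 1`, and the
edge `p + 1` lie in the same long arc if the point `p + 1` is not classical.  If there is no
classical crossing, the only long arc is the whole circle. -/
def LongArc : Type := Quot fun p q : ZMod n => q = p + 1 ∧ ¬ D.IsClassical q

/-- The long arc that contains the edge of the curve from `p` to `p + 1`. -/
def arcOf (p : ZMod n) : D.LongArc := Quot.mk _ p

/-- The edges of the Gauss diagram: the edges of the oriented core circle and the chords. -/
abbrev GaussEdge : Type := D.LongArc ⊕ D.Chord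

/-- The upper end of a chord. -/
def Chord.overEnd {D : VirtualKnotDiagram n} (c : D.Chord) : D.GaussVertex :=
  ⟨c.1, Or.inl c.2⟩

/-- The lower end of a chord. -/
def Chord.underEnd {D : VirtualKnotDiagram n} (c : D.Chord) : D.GaussVertex :=
  ⟨D.opp c.1, Or.inr ((D.over_iff_under c.1).1 c.2)⟩

/-- The group `C⁰(G, ℤ)` of the Gauss diagram `G`. -/
abbrev C0 : Type := D.GaussVertex → ℤ

/-- The group `C¹(G, ℤ)` of the Gauss diagram `G`.  As `G` is a graph, each of its elements is a
cocycle. -/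
abbrev C1 : Type := D.GaussEdge → ℤ

open Classical in
/-- The coboundary `C⁰(G, ℤ) → C¹(G, ℤ)`: the value at the end of an edge minus the value at its
beginning. (A circle without vertices has coboundary `0`.) -/
noncomputable def coboundary : D.C0 →+ D.C1 where
  toFun f := Sum.elim
    (fun a => (∑ v : D.GaussVertex, if D.arcOf (v.1 - 1) = a then f v else 0)
      - ∑ v : D.GaussVertex, if D.arcOf v.1 = a then f v else 0)
    (fun c => f c.underEnd - f c.overEnd)
  map_zero' := by
    funext e
    cases e <;> simp
  map_add' f g := by
    funext e
    cases e with
    | inl a =>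
      simp only [Pi.add_apply, Sum.elim_inl, ← Finset.sum_filter, Finset.sum_add_distrib]
      ring
    | inr c =>
      simp only [Pi.add_apply, Sum.elim_inr]
      ring

/-- The cohomology group `H¹(G, ℤ)` of the Gauss diagram. -/
abbrev H1 : Type := D.C1 ⧸ D.coboundary.range

/-- The cohomology class of a cocycle. -/
noncomputable def cohomologyClass (i : D.C1) : D.H1 := QuotientAddGroup.mk i

/-! ### The index class -/

open Classical in
/-- The virtual index cocycle on the edges of the covering graph: the sum of the signs of the
virtual crossings met along a long arc, where a virtual crossing counts `1` if the other strand
crosses the arc from right to left and `-1` otherwise. -/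
noncomputable def virtualIndexOnArcs (a : D.LongArc) : ℤ :=
  ∑ p : ZMod n, if D.kind p = PointKind.virt ∧ D.arcOf p = a then D.crossSign p else 0

/-- The virtual index cocycle on the Gauss diagram: the pullback along the projection which
collapses each chord to a point. -/
noncomputable def virtualIndexCocycle : D.C1 := Sum.elim D.virtualIndexOnArcs 0

/-- The index class in `H¹(G, ℤ)`. -/
noncomputable def indexClass : D.H1 := D.cohomologyClass D.virtualIndexCocycle

/-! ### The index of a classical crossing -/

/-- The marked points strictly between `p` and `q` on the way from `p` to `q` along the curve
(`p ≠ q`). -/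
def between (p q : ZMod n) : Finset (ZMod n) :=
  Finset.univ.filter fun x => 0 < (x - p).val ∧ (x - p).val < (q - p).val

/-- The sign of a classical crossing: `1` if the lower strand crosses the upper one from right to
left, `-1` if from left to right. -/
def sign (c : D.Chord) : ℤ := D.crossSign c.1

/-- The passage of the crossing `c` whose strand goes from the right to the left of the other
strand. -/
def leftward (c : D.Chord) : ZMod n := if D.toLeft c.1 then D.opp c.1 else c.1

/-- The passage of the crossing `c` whose strand goes from the left to the right of the other
strand. -/
def rightward (c : D.Chord) : ZMod n := if D.toLeft c.1 then c.1 else D.opp c.1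

/-- The left half of the diagram at `c`, given by the marked points in it other than `c`: the half
which contains the left branch of the oriented smoothing at `c`.  It leaves the crossing with the
strand which goes to the left and returns to it with the other strand. -/
def leftHalf (c : D.Chord) : Finset (ZMod n) := between (D.leftward c) (D.rightward c)

/-- The right half of the diagram at `c`. -/
def rightHalf (c : D.Chord) : Finset (ZMod n) := between (D.rightward c) (D.leftward c)

/-- The positive half: the left half at a positive crossing, the right half at a negative one. -/
def positiveHalf (c : D.Chord) : Finset (ZMod n) :=
  if D.sign c = 1 then D.leftHalf c else D.rightHalf c

/-- The index of the classical crossing `c`: the sum of the intersection numbers of the classical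
crossings met along the positive half, where a crossing counts `1` if the other strand crosses
from left to right and `-1` if it crosses from right to left. -/
def index (c : D.Chord) : ℤ :=
  ∑ p ∈ D.positiveHalf c, if D.IsClassical p then -D.crossSign p else 0

end VirtualKnotDiagram

namespace CurveDiagram

variable {n : ℕ} [NeZero n] (D : CurveDiagram n)

/-! ### Planarity and Alexander numberings -/

/-! A chord of `G` runs from its upper to its lower end, and the core path from the lower end back
to the upper end closes it to a cycle. Coboundaries vanish on cycles, so a representative of the
index class that is zero on the core takes on `c` the value of the virtual index along this path.
This gives uniqueness (`eq_index_of_indexClass`). For existence, the two passages of a virtual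
crossing have opposite signs, so the virtual index sums to zero around the core and is a coboundary
there (`exists_indexClass_eq_and_vanish`).

The path is the positive half at `c`, whatever the sign of `c` (`positiveHalf_eq`). In the plane the
signs of all crossings met along this half, classical and virtual, sum to zero
(`sum_between_crossSign`), so the virtual sum is minus the classical one, which is the index.

Planarity enters only through an Alexander numbering of the faces. Vertex and face differences span
orthogonal subspaces of `ℚ^n`, of dimension at least `V - 1` and `F - 1`; by Euler's formula they
fill it. The constant `1` is orthogonal to all vertex differences, hence is a face difference. -/

lemma otherHalf_otherHalf {n : ℕ} (h : ZMod n × Bool) : otherHalf (otherHalf h) = h := by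
  obtain ⟨p, b⟩ := h
  cases b <;> simp [otherHalf]

lemma kind_opp_eq_marker_iff (p : ZMod n) :
    D.kind (D.opp p) = PointKind.marker ↔ D.kind p = PointKind.marker := by
  rw [← D.opp_eq_self_iff, ← D.opp_eq_self_iff, D.opp_opp, eq_comm]

lemma rot_rot_of_ne_marker {p : ZMod n} (hp : D.kind p ≠ PointKind.marker) (b : Bool) :
    D.rot (D.rot (p, b)) = (p, !b) := by
  have hq : D.kind (D.opp p) ≠ PointKind.marker := by rwa [Ne, D.kind_opp_eq_marker_iff]
  cases h : D.toLeft p <;> simp [rot, hp, hq, D.opp_opp, D.toLeft_opp p hp, h]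

lemma rot_of_marker {p : ZMod n} (hp : D.kind p = PointKind.marker) (b : Bool) :
    D.rot (p, b) = (p, !b) := by
  simp [rot, hp]

lemma rot_iterate_four (h : ZMod n × Bool) : D.rot (D.rot (D.rot (D.rot h))) = h := by
  obtain ⟨p, b⟩ := h
  by_cases hp : D.kind p = PointKind.marker
  · simp [D.rot_of_marker hp]
  · simp [D.rot_rot_of_ne_marker hp]

lemma rot_bijective : Function.Bijective D.rot :=
  Finite.injective_iff_bijective.1 fun h k e => by
    rw [← D.rot_iterate_four h, e, D.rot_iterate_four]

/-- The vertex at which the curve has the point `p`. -/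
def vertexOf (p : ZMod n) : D.MapVertex := Quot.mk _ p

/-- The face to the right of a half-edge. -/
def faceOf (h : ZMod n × Bool) : D.MapFace := Quot.mk _ h

instance : Finite D.MapVertex := inferInstanceAs (Finite (Quot _))

instance : Finite D.MapFace := inferInstanceAs (Finite (Quot _))

lemma vertexOf_opp (p : ZMod n) : D.vertexOf (D.opp p) = D.vertexOf p :=
  (Quot.sound (r := fun p q : ZMod n => q = D.opp p) rfl).symm

lemma vertexOf_rot (h : ZMod n × Bool) : D.vertexOf (D.rot h).1 = D.vertexOf h.1 := by
  unfold rot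
  split_ifs <;> simp [vertexOf_opp]

lemma faceOf_rot (h : ZMod n × Bool) : D.faceOf (D.rot h) = D.faceOf (otherHalf h) := by
  have : D.faceOf (otherHalf h) = D.faceOf (D.rot (otherHalf (otherHalf h))) :=
    Quot.sound (r := fun h k : ZMod n × Bool => k = D.rot (otherHalf h)) rfl
  rw [this, otherHalf_otherHalf]

/-- The coboundary of a function on the vertices, on the oriented edges of the curve. -/
def vertexDiff : (D.MapVertex → ℚ) →ₗ[ℚ] (ZMod n → ℚ) where
  toFun f p := f (D.vertexOf (p + 1)) - f (D.vertexOf p)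
  map_add' f g := by funext p; simp only [Pi.add_apply]; ring
  map_smul' r f := by
    funext p; simp only [Pi.smul_apply, smul_eq_mul, RingHom.id_apply]; ring

/-- The difference of a function on the faces across the edges of the curve: the value to the
left minus the value to the right. -/
def faceDiff : (D.MapFace → ℚ) →ₗ[ℚ] (ZMod n → ℚ) where
  toFun a p := a (D.faceOf (p + 1, false)) - a (D.faceOf (p, true))
  map_add' f g := by funext p; simp only [Pi.add_apply]; ring
  map_smul' r f := by
    funext p; simp only [Pi.smul_apply, smul_eq_mul, RingHom.id_apply]; ring

lemma sum_vertexDiff (f : D.MapVertex → ℚ) : ∑ p, D.vertexDiff f p = 0 := by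
  simp only [vertexDiff, LinearMap.coe_mk, AddHom.coe_mk, Finset.sum_sub_distrib]
  rw [sub_eq_zero]
  exact Equiv.sum_comp (Equiv.addRight (1 : ZMod n)) fun p => f (D.vertexOf p)

/-- Around each vertex the face differences telescope to zero. Summed over half-edges, this is
invariance under the permutation `rot`, which fixes the vertex and carries the face of `otherHalf h`
to that of `rot h`. -/
lemma sum_vertexDiff_mul_faceDiff (f : D.MapVertex → ℚ) (a : D.MapFace → ℚ) :
    ∑ p, D.vertexDiff f p * D.faceDiff a p = 0 := by
  have key : ∑ h : ZMod n × Bool,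
      f (D.vertexOf h.1) * (a (D.faceOf h) - a (D.faceOf (otherHalf h))) = 0 := by
    simp only [mul_sub, Finset.sum_sub_distrib, sub_eq_zero]
    rw [← D.rot_bijective.sum_comp]
    simp only [vertexOf_rot, faceOf_rot]
  rw [Fintype.sum_prod_type] at key
  simp only [Fintype.sum_bool, Finset.sum_add_distrib] at key
  rw [← Equiv.sum_comp (Equiv.addRight (1 : ZMod n)) (fun p => f (D.vertexOf p) *
    (a (D.faceOf (p, false)) - a (D.faceOf (otherHalf (p, false))))),
    ← Finset.sum_add_distrib] at key
  rw [← key]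
  refine Finset.sum_congr rfl fun p _ => ?_
  simp [vertexDiff, faceDiff, otherHalf]
  ring

end CurveDiagram

lemma ZMod.eq_of_forall_add_one_eq {n : ℕ} [NeZero n] {α : Type*} {g : ZMod n → α}
    (h : ∀ p, g (p + 1) = g p) (p q : ZMod n) : g p = g q := by
  have key : ∀ k : ℕ, g k = g 0 := by
    intro k
    induction k with
    | zero => simp
    | succ k ih => rw [Nat.cast_succ, h, ih]
  rw [← ZMod.natCast_zmod_val p, ← ZMod.natCast_zmod_val q, key, key]

/-- A linear map on functions whose kernel consists of constants has at most one-dimensional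
kernel. -/
lemma LinearMap.card_le_finrank_range_add_one {α W : Type*} [Finite α] [AddCommGroup W]
    [Module ℚ W] (d : (α → ℚ) →ₗ[ℚ] W) (h : ∀ f, d f = 0 → ∀ x y, f x = f y) :
    Nat.card α ≤ Module.finrank ℚ (LinearMap.range d) + 1 := by
  have := Fintype.ofFinite α
  have h1 := d.finrank_range_add_finrank_ker
  rw [Module.finrank_fintype_fun_eq_card, ← Nat.card_eq_fintype_card] at h1
  have h2 : LinearMap.ker d ≤ Submodule.span ℚ {fun _ => (1 : ℚ)} := by
    intro f hf
    rw [Submodule.mem_span_singleton]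
    rcases isEmpty_or_nonempty α with hα | ⟨⟨x⟩⟩
    · exact ⟨0, Subsingleton.elim _ _⟩
    · refine ⟨f x, ?_⟩
      funext y
      simpa using h f hf x y
  have h3 := (Submodule.finrank_mono h2).trans (finrank_span_le_card _)
  simp only [Set.toFinset_singleton, Finset.card_singleton] at h3
  omega

namespace CurveDiagram

variable {n : ℕ} [NeZero n] (D : CurveDiagram n)

lemma eq_of_vertexDiff_eq_zero (f : D.MapVertex → ℚ) (hf : D.vertexDiff f = 0)
    (v w : D.MapVertex) : f v = f w := by
  induction v using Quot.ind with | mk p =>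
  induction w using Quot.ind with | mk q =>
  exact ZMod.eq_of_forall_add_one_eq (g := fun p => f (D.vertexOf p))
    (fun p => sub_eq_zero.1 (congrFun hf p)) p q

/-- The value does not change across an edge, hence not under `rot`. Turning around a point reaches
both its half-edges on the curve, and the single curve visits all points. -/
lemma eq_of_faceDiff_eq_zero (a : D.MapFace → ℚ) (ha : D.faceDiff a = 0)
    (s t : D.MapFace) : a s = a t := by
  have h1 : ∀ p, a (D.faceOf (p + 1, false)) = a (D.faceOf (p, true)) := fun p =>
    sub_eq_zero.1 (congrFun ha p)
  have h2 : ∀ h, a (D.faceOf (D.rot h)) = a (D.faceOf h) := by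
    rintro ⟨p, b⟩
    rw [faceOf_rot]
    cases b
    · simpa [otherHalf] using (h1 (p - 1)).symm
    · simpa [otherHalf] using h1 p
  have h3 : ∀ p b, a (D.faceOf (p, !b)) = a (D.faceOf (p, b)) := by
    intro p b
    by_cases hp : D.kind p = PointKind.marker
    · rw [← D.rot_of_marker hp, h2]
    · rw [← D.rot_rot_of_ne_marker hp, h2, h2]
  have h4 : ∀ p b, a (D.faceOf (p, b)) = a (D.faceOf (p, true)) := by
    rintro p (_ | _)
    · exact h3 p true
    · rfl
  induction s using Quot.ind with | mk s =>
  induction t using Quot.ind with | mk t =>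
  refine (h4 s.1 s.2).trans (Eq.trans ?_ (h4 t.1 t.2).symm)
  exact ZMod.eq_of_forall_add_one_eq (g := fun p => a (D.faceOf (p, true)))
    (fun p => (h4 (p + 1) false).symm.trans (h1 p)) s.1 t.1

/-- A curve in the plane has an Alexander numbering of its faces. -/
theorem IsPlanar.exists_faceDiff_eq_one {D : CurveDiagram n} (hD : D.IsPlanar) :
    ∃ a : D.MapFace → ℚ, ∀ p, a (D.faceOf (p + 1, false)) - a (D.faceOf (p, true)) = 1 := by
  have hV := D.vertexDiff.card_le_finrank_range_add_one D.eq_of_vertexDiff_eq_zero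
  have hF := D.faceDiff.card_le_finrank_range_add_one D.eq_of_faceDiff_eq_zero
  have hinf : LinearMap.range D.vertexDiff ⊓ LinearMap.range D.faceDiff = ⊥ := by
    rw [eq_bot_iff]
    rintro x ⟨⟨f, hf⟩, ⟨a, ha⟩⟩
    have h := D.sum_vertexDiff_mul_faceDiff f a
    rw [hf, ha, Finset.sum_eq_zero_iff_of_nonneg fun p _ => mul_self_nonneg _] at h
    rw [Submodule.mem_bot]
    funext p
    exact mul_self_eq_zero.1 (h p (Finset.mem_univ p))
  have hdim := Submodule.finrank_sup_add_finrank_inf_eq (LinearMap.range D.vertexDiff)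
    (LinearMap.range D.faceDiff)
  rw [hinf, finrank_bot] at hdim
  have htop : LinearMap.range D.vertexDiff ⊔ LinearMap.range D.faceDiff = ⊤ := by
    -- The two ranks add up to at least `(V - 1) + (F - 1) = n`.
    refine Submodule.eq_top_of_finrank_eq (le_antisymm (Submodule.finrank_le _) ?_)
    rw [Module.finrank_fintype_fun_eq_card, ZMod.card]
    unfold IsPlanar at hD
    omega
  have hone : (fun _ => 1 : ZMod n → ℚ) ∈
      LinearMap.range D.vertexDiff ⊔ LinearMap.range D.faceDiff := htop ▸ Submodule.mem_top
  obtain ⟨_, ⟨f, rfl⟩, _, ⟨a, rfl⟩, hfa⟩ := Submodule.mem_sup.1 hone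
  -- With `1 = df + da`, the square norm of `df` is `⟨df, 1⟩ - ⟨df, da⟩ = 0`.
  have hsq : ∑ p, D.vertexDiff f p * D.vertexDiff f p = 0 := by
    have h := D.sum_vertexDiff f
    have h' := D.sum_vertexDiff_mul_faceDiff f a
    have e : ∀ p, D.faceDiff a p = 1 - D.vertexDiff f p := fun p => by
      rw [← congrFun hfa p, Pi.add_apply, add_sub_cancel_left]
    simp only [e, mul_sub, mul_one, Finset.sum_sub_distrib, h] at h'
    linarith
  rw [Finset.sum_eq_zero_iff_of_nonneg fun p _ => mul_self_nonneg _] at hsq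
  refine ⟨a, fun p => ?_⟩
  have h := congrFun hfa p
  rwa [Pi.add_apply, mul_self_eq_zero.1 (hsq p (Finset.mem_univ p)), zero_add] at h

end CurveDiagram

/-! ### Sums along a cyclically ordered set of points -/

/-- Partial sums from `0` work; the vanishing total makes them consistent where the circle closes
up. -/
lemma ZMod.exists_sub_eq_of_sum_eq_zero {n : ℕ} [NeZero n] {M : Type*} [AddCommGroup M]
    (g : ZMod n → M) (hg : ∑ p, g p = 0) : ∃ S : ZMod n → M, ∀ p, S p - S (p - 1) = g p := by
  let T : ℕ → M := fun k => ∑ j ∈ Finset.range k, g j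
  have hn : T n = 0 := by
    rw [← hg]
    refine Finset.sum_nbij' (fun j : ℕ => (j : ZMod n)) ZMod.val ?_ ?_ ?_ ?_ ?_
    · simp
    · intro p _; simpa using ZMod.val_lt p
    · intro j hj; exact ZMod.val_cast_of_lt (Finset.mem_range.1 hj)
    · intro p _; exact ZMod.natCast_zmod_val p
    · simp
  have hT : ∀ p : ZMod n, T (p.val + 1) = T p.val + g p := fun p => by
    simp only [T, Finset.sum_range_succ, ZMod.natCast_zmod_val]
  have hpred : ∀ p : ZMod n, T ((p - 1).val + 1) = T p.val := by
    intro p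
    have h : (((p - 1).val + 1 : ℕ) : ZMod n) = p := by simp
    have hv := congrArg ZMod.val h
    rw [ZMod.val_natCast] at hv
    rcases Nat.lt_or_eq_of_le (Nat.succ_le_of_lt (ZMod.val_lt (p - 1))) with hlt | heq
    · rw [← hv, Nat.mod_eq_of_lt hlt]
    · rw [Nat.succ_eq_add_one] at heq
      rw [← hv, heq, Nat.mod_self, hn]
      simp [T]
  refine ⟨fun p => T (p.val + 1), fun p => ?_⟩
  beta_reduce
  rw [hpred, hT, add_sub_cancel_left]

namespace VirtualKnotDiagram

lemma sum_between_sub {n : ℕ} [NeZero n] {M : Type*} [AddCommGroup M] (G : ZMod n → M)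
    {u o : ZMod n} (h : u ≠ o) :
    ∑ x ∈ between u o, (G x - G (x - 1)) = G (o - 1) - G u := by
  obtain ⟨m, hm⟩ : ∃ m, (o - u).val = m + 1 :=
    Nat.exists_eq_succ_of_ne_zero fun h0 => h (sub_eq_zero.1 ((ZMod.val_eq_zero _).1 h0)).symm
  have hmn : m + 1 < n := hm ▸ ZMod.val_lt (o - u)
  have ho : o - 1 = u + (m : ℕ) := by
    have := ZMod.natCast_zmod_val (o - u)
    rw [hm, Nat.cast_succ] at this
    linear_combination -this
  have hs := Finset.sum_range_sub (fun k : ℕ => G (u + k)) m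
  rw [ho, ← show G (u + (0 : ℕ)) = G u by simp, ← hs]
  symm
  refine Finset.sum_nbij' (fun k : ℕ => u + ((k + 1 : ℕ) : ZMod n)) (fun x => (x - u).val - 1)
    ?_ ?_ ?_ ?_ ?_
  · intro k hk
    have hk := Finset.mem_range.1 hk
    simp only [between, Finset.mem_filter, Finset.mem_univ, true_and, add_sub_cancel_left, hm]
    rw [ZMod.val_cast_of_lt (by omega)]
    omega
  · intro x hx
    simp only [between, Finset.mem_filter, Finset.mem_univ, true_and, hm] at hx
    rw [Finset.mem_range]
    omega
  · intro k hk
    have hk := Finset.mem_range.1 hk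
    simp only [add_sub_cancel_left]
    rw [ZMod.val_cast_of_lt (by omega)]
    omega
  · intro x hx
    simp only [between, Finset.mem_filter, Finset.mem_univ, true_and, hm] at hx
    rw [Nat.sub_add_cancel hx.1, ZMod.natCast_zmod_val]
    ring
  · intro k _
    have : u + ((k + 1 : ℕ) : ZMod n) - 1 = u + (k : ℕ) := by push_cast; ring
    rw [this]

/-- The indicator function of the edges of the curve on the way from `u` to `o`. -/
def pathIndicator {n : ℕ} (u o p : ZMod n) : ℤ := if (p - u).val < (o - u).val then 1 else 0

lemma pathIndicator_sub_one_sub {n : ℕ} [NeZero n] {u o : ZMod n} (h : u ≠ o) (p : ZMod n) :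
    pathIndicator u o (p - 1) - pathIndicator u o p =
      (if p = o then 1 else 0) - (if p = u then 1 else 0) := by
  unfold pathIndicator
  have ho : (o - u).val ≠ 0 := fun h0 => h (sub_eq_zero.1 ((ZMod.val_eq_zero _).1 h0)).symm
  have hon := ZMod.val_lt (o - u)
  have hn : n ≠ 1 := by rintro rfl; omega
  have : Fact (1 < n) := ⟨by have := NeZero.ne n; omega⟩
  by_cases hpu : p = u
  · subst hpu
    have h1 : (p - 1 - p).val = n - 1 := by
      rw [show p - 1 - p = -1 by ring, ZMod.val_neg_of_ne_zero, ZMod.val_one]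
    rw [h1, if_neg (by omega), if_neg h, if_pos (by simpa using Nat.pos_of_ne_zero ho),
      if_pos rfl]
  · have hx : (p - u).val ≠ 0 := fun h0 => hpu (sub_eq_zero.1 ((ZMod.val_eq_zero _).1 h0))
    have h1 : (p - 1 - u).val = (p - u).val - 1 := by
      rw [show p - 1 - u = (p - u) - 1 by ring, ZMod.val_sub, ZMod.val_one]
      rw [ZMod.val_one]; omega
    have hpo : p = o ↔ (p - u).val = (o - u).val := by
      rw [(ZMod.val_injective n).eq_iff, sub_left_inj]
    rw [h1, if_neg hpu]
    simp only [hpo]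
    split_ifs <;> omega

variable {n : ℕ} [NeZero n] (D : VirtualKnotDiagram n)

/-! ### Vanishing of the total intersection number along a half -/

lemma crossSign_opp {p : ZMod n} (hp : D.kind p ≠ PointKind.marker) :
    D.crossSign (D.opp p) = -D.crossSign p := by
  unfold crossSign
  rw [D.toLeft_opp p hp]
  cases D.toLeft p <;> simp

/-- The numbers of the faces to the left of the edges in an Alexander numbering of the plane. -/
theorem exists_alexanderNumbering : ∃ A : ZMod n → ℚ,
    (∀ p, A p - A (p - 1) = if D.kind p = PointKind.marker then 0 else -(D.crossSign p : ℚ)) ∧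
    ∀ p, D.kind p ≠ PointKind.marker → A (D.opp p) = A (p - 1) := by
  obtain ⟨a, ha⟩ := D.planar.exists_faceDiff_eq_one
  have hleft : ∀ p, a (D.faceOf (p, false)) = a (D.faceOf (p - 1 + 1, false)) := fun p => by
    rw [sub_add_cancel]
  have hT : ∀ p, a (D.faceOf (D.rot (p, true))) = a (D.faceOf (p + 1, false)) := fun p =>
    congrArg a (D.faceOf_rot _)
  have hF : ∀ p, a (D.faceOf (D.rot (p, false))) = a (D.faceOf (p - 1, true)) := fun p =>
    congrArg a (D.faceOf_rot _)
  -- The corners of a crossing whose other strand goes to the left. The opposite case follows by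
  -- exchanging the two passages.
  have hq : ∀ p, D.kind p ≠ PointKind.marker → D.toLeft p = true →
      a (D.faceOf (D.opp p + 1, false)) = a (D.faceOf (p, false)) ∧
      a (D.faceOf (p + 1, false)) = a (D.faceOf (D.opp p, false)) ∧
      a (D.faceOf (D.opp p, false)) = a (D.faceOf (p, false)) - 1 := by
    intro p hp hl
    have hp' : D.kind (D.opp p) ≠ PointKind.marker := by rwa [Ne, D.kind_opp_eq_marker_iff]
    have hl' : D.toLeft (D.opp p) = false := by rw [D.toLeft_opp p hp, hl]; rfl
    have e1 : D.rot (p, true) = (D.opp p, true) := by simp [CurveDiagram.rot, hp, hl]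
    have e2 : D.rot (p, false) = (D.opp p, false) := by simp [CurveDiagram.rot, hp, hl]
    have e3 : D.rot (D.opp p, true) = (p, false) := by
      simp [CurveDiagram.rot, hp', hl', D.opp_opp]
    have h1 := hT p
    have h2 := hF p
    have h3 := hT (D.opp p)
    rw [e1] at h1
    rw [e2] at h2
    rw [e3] at h3
    have h4 := ha (p - 1)
    have h5 := ha (D.opp p)
    rw [← hleft] at h4
    refine ⟨h3.symm, ?_, ?_⟩ <;> linarith
  have hopp : ∀ p, D.kind p ≠ PointKind.marker → D.toLeft p = false →
      D.kind (D.opp p) ≠ PointKind.marker ∧ D.toLeft (D.opp p) = true := fun p hp hl =>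
    ⟨by rwa [Ne, D.kind_opp_eq_marker_iff], by rw [D.toLeft_opp p hp, hl]; rfl⟩
  refine ⟨fun p => a (D.faceOf (p + 1, false)), fun p => ?_, fun p hp => ?_⟩
  · simp only [← hleft]
    split_ifs with hp
    · rw [← hT, D.rot_of_marker hp]
      simp
    · cases hl : D.toLeft p
      · obtain ⟨hp', hl'⟩ := hopp p hp hl
        have h := hq _ hp' hl'
        rw [D.opp_opp] at h
        simp only [crossSign, hl]
        simp only [Bool.false_eq_true, if_false]
        push_cast
        linarith [h.1, h.2.2]
      · have h := hq p hp hl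
        simp only [crossSign, hl]
        simp only [if_true]
        push_cast
        linarith [h.2.1, h.2.2]
  -- If the other strand goes to the left, both sides number the same face; otherwise they number
  -- opposite corners, whose numbers agree.
  · simp only [← hleft]
    cases hl : D.toLeft p
    · obtain ⟨hp', hl'⟩ := hopp p hp hl
      have h := hq _ hp' hl'
      rw [D.opp_opp] at h
      exact h.2.1
    · exact (hq p hp hl).1

/-- The numbering drops by the sign at each crossing, and it has the same value when the half leaves
the crossing as when it returns. -/
theorem sum_between_crossSign {p : ZMod n} (hp : D.kind p ≠ PointKind.marker) :
    ∑ x ∈ between (D.opp p) p, (if D.kind x = PointKind.marker then 0 else D.crossSign x) = 0 := by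
  obtain ⟨A, hA, hA'⟩ := D.exists_alexanderNumbering
  have h := sum_between_sub A (fun e => hp ((D.opp_eq_self_iff p).1 e))
  rw [hA' p hp, sub_self] at h
  simp only [hA] at h
  rw [← neg_eq_zero, ← Finset.sum_neg_distrib]
  have h2 : ((∑ x ∈ between (D.opp p) p,
      -(if D.kind x = PointKind.marker then 0 else D.crossSign x) : ℤ) : ℚ) = 0 := by
    rw [← h]
    push_cast
    refine Finset.sum_congr rfl fun x _ => ?_
    split_ifs <;> simp
  exact_mod_cast h2

/-! ### The index -/

/-- The contribution of the point `p` to the virtual index cocycle. -/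
def virtualSign (p : ZMod n) : ℤ := if D.kind p = PointKind.virt then D.crossSign p else 0

lemma virtualSign_of_isClassical {p : ZMod n} (hp : D.IsClassical p) : D.virtualSign p = 0 := by
  rcases hp with hp | hp <;> simp [virtualSign, hp]

lemma kind_opp_eq_virt_iff (p : ZMod n) :
    D.kind (D.opp p) = PointKind.virt ↔ D.kind p = PointKind.virt := by
  have h1 := D.kind_opp_eq_marker_iff p
  have h2 := D.over_iff_under p
  have h3 := D.over_iff_under (D.opp p)
  rw [D.opp_opp] at h3
  cases h : D.kind p <;> cases h' : D.kind (D.opp p) <;> simp_all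

lemma sum_virtualSign : ∑ p, D.virtualSign p = 0 := by
  have hinv : Function.Involutive D.opp := D.opp_opp
  have h := hinv.bijective.sum_comp D.virtualSign
  have h2 : ∀ p, D.virtualSign (D.opp p) = -D.virtualSign p := by
    intro p
    unfold virtualSign
    simp only [D.kind_opp_eq_virt_iff]
    split_ifs with hp
    · exact D.crossSign_opp (by simp [hp])
    · simp
  simp only [h2, Finset.sum_neg_distrib] at h
  omega

/-- The lower strand is the leftward one at a positive crossing and the rightward one at a negative
crossing, so the positive half always leaves along it. -/
lemma positiveHalf_eq (c : D.Chord) : D.positiveHalf c = between (D.opp c.1) c.1 := by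
  unfold positiveHalf sign crossSign leftHalf rightHalf leftward rightward
  cases D.toLeft c.1 <;> simp

theorem index_eq_sum_virtualSign (c : D.Chord) :
    D.index c = ∑ p ∈ between (D.opp c.1) c.1, D.virtualSign p := by
  have h := D.sum_between_crossSign (p := c.1) (by simp [c.2])
  unfold index
  rw [D.positiveHalf_eq, ← sub_eq_zero, ← Finset.sum_sub_distrib, ← neg_eq_zero,
    ← Finset.sum_neg_distrib]
  refine Eq.trans ?_ h
  refine Finset.sum_congr rfl fun p _ => ?_
  unfold virtualSign
  by_cases hc : D.IsClassical p
  · rw [if_pos hc]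
    rcases hc with hp | hp <;> simp [hp]
  · rw [if_neg hc]
    cases hp : D.kind p <;> simp_all

/-! ### Cochains on the core circle -/

instance : Finite D.LongArc := inferInstanceAs (Finite (Quot _))

lemma arcOf_sub_one {p : ZMod n} (hp : ¬ D.IsClassical p) : D.arcOf (p - 1) = D.arcOf p :=
  Quot.sound ⟨by ring, hp⟩

lemma sum_mul_virtualIndexOnArcs [Fintype D.LongArc] (ψ : D.LongArc → ℤ) :
    ∑ a, ψ a * D.virtualIndexOnArcs a = ∑ p, ψ (D.arcOf p) * D.virtualSign p := by
  classical
  simp only [virtualIndexOnArcs, Finset.mul_sum]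
  rw [Finset.sum_comm]
  refine Finset.sum_congr rfl fun p _ => ?_
  rw [Finset.sum_eq_single (D.arcOf p)]
  · simp [virtualSign]
  · intro a _ ha
    simp [ha.symm]
  · simp

/-- Summation by parts: the coefficient of `f v` is the boundary of the chain `ψ` at `v`. -/
lemma sum_mul_coboundary [Fintype D.LongArc] (ψ : D.LongArc → ℤ) (f : D.C0) :
    ∑ a, ψ a * D.coboundary f (Sum.inl a) =
      ∑ v : D.GaussVertex, (ψ (D.arcOf (v.1 - 1)) - ψ (D.arcOf v.1)) * f v := by
  classical
  simp only [coboundary, AddMonoidHom.coe_mk, ZeroHom.coe_mk, Sum.elim_inl, mul_sub, sub_mul,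
    Finset.mul_sum, Finset.sum_sub_distrib]
  congr 1 <;>
  · rw [Finset.sum_comm]
    refine Finset.sum_congr rfl fun v _ => ?_
    simp

lemma coboundary_inr (f : D.C0) (c : D.Chord) :
    D.coboundary f (Sum.inr c) = f c.underEnd - f c.overEnd := rfl

lemma cohomologyClass_eq_indexClass_iff (i : D.C1) :
    D.cohomologyClass i = D.indexClass ↔ ∃ f, i = D.virtualIndexCocycle + D.coboundary f := by
  unfold cohomologyClass indexClass cohomologyClass
  rw [eq_comm, QuotientAddGroup.eq]
  constructor
  · rintro ⟨f, hf⟩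
    exact ⟨f, by rw [hf]; abel⟩
  · rintro ⟨f, rfl⟩
    exact ⟨f, by abel⟩

lemma opp_ne_self (c : D.Chord) : D.opp c.1 ≠ c.1 := by
  rw [Ne, D.opp_eq_self_iff, c.2]
  simp

lemma sum_pathIndicator_mul_virtualSign (c : D.Chord) :
    ∑ p, pathIndicator (D.opp c.1) c.1 p * D.virtualSign p = D.index c := by
  rw [D.index_eq_sum_virtualSign, between, Finset.sum_filter]
  refine Finset.sum_congr rfl fun p _ => ?_
  -- The path indicator counts its starting point, which `between` omits; that point is classical
  -- and contributes zero.
  by_cases hp : p = D.opp c.1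
  · have := D.virtualSign_of_isClassical (Or.inr ((D.over_iff_under c.1).1 c.2))
    subst hp
    simp [this]
  · have hx : 0 < (p - D.opp c.1).val := Nat.pos_of_ne_zero fun h0 =>
      hp (sub_eq_zero.1 ((ZMod.val_eq_zero _).1 h0))
    simp [pathIndicator, hx]

/-- A representative of the index class that vanishes on the core circle is the index on the
chords. -/
theorem eq_index_of_indexClass {i : D.C1} (hi : D.cohomologyClass i = D.indexClass)
    (h0 : ∀ a, i (Sum.inl a) = 0) (c : D.Chord) : i (Sum.inr c) = D.index c := by
  classical
  have := Fintype.ofFinite D.LongArc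
  obtain ⟨f, rfl⟩ := (D.cohomologyClass_eq_indexClass_iff i).1 hi
  have hne := D.opp_ne_self c
  -- The core path as a chain of long arcs: its indicator jumps only at the two ends of the chord,
  -- which are classical.
  let ψ : D.LongArc → ℤ := Quot.lift (pathIndicator (D.opp c.1) c.1) (by
    rintro p q ⟨rfl, hq⟩
    have h := pathIndicator_sub_one_sub hne (p + 1)
    rw [if_neg, if_neg, add_sub_cancel_right] at h
    · omega
    · rintro e; exact hq (e ▸ Or.inr ((D.over_iff_under c.1).1 c.2))
    · rintro e; exact hq (e ▸ Or.inl c.2))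
  have hψ : ∀ p, ψ (D.arcOf p) = pathIndicator (D.opp c.1) c.1 p := fun _ => rfl
  have hsum : ∑ a, ψ a * D.virtualIndexOnArcs a + ∑ a, ψ a * D.coboundary f (Sum.inl a) = 0 := by
    rw [← Finset.sum_add_distrib]
    refine Finset.sum_eq_zero fun a _ => ?_
    rw [← mul_add]
    exact mul_eq_zero_of_right _ (h0 a)
  rw [D.sum_mul_virtualIndexOnArcs, D.sum_mul_coboundary] at hsum
  simp only [hψ, pathIndicator_sub_one_sub hne, D.sum_pathIndicator_mul_virtualSign] at hsum
  have hends : ∑ v : D.GaussVertex,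
      ((if v.1 = c.1 then 1 else 0) - (if v.1 = D.opp c.1 then 1 else 0)) * f v =
      f c.overEnd - f c.underEnd := by
    simp only [sub_mul, Finset.sum_sub_distrib]
    congr 1
    · rw [Finset.sum_eq_single c.overEnd]
      · simp [Chord.overEnd]
      · intro v _ hv
        rw [if_neg (show ¬ v.1 = c.1 from fun e => hv (Subtype.ext e)), zero_mul]
      · simp
    · rw [Finset.sum_eq_single c.underEnd]
      · simp [Chord.underEnd]
      · intro v _ hv
        rw [if_neg (show ¬ v.1 = D.opp c.1 from fun e => hv (Subtype.ext e)), zero_mul]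
      · simp
  rw [hends] at hsum
  have hc : (D.virtualIndexCocycle + D.coboundary f) (Sum.inr c) =
      f c.underEnd - f c.overEnd := by
    rw [Pi.add_apply, D.coboundary_inr]
    simp [virtualIndexCocycle]
  rw [hc]
  omega

/-- The index class has a representative that vanishes on the core circle. -/
theorem exists_indexClass_eq_and_vanish : ∃ i : D.C1,
    D.cohomologyClass i = D.indexClass ∧ ∀ a : D.LongArc, i (Sum.inl a) = 0 := by
  classical
  obtain ⟨S, hS⟩ := ZMod.exists_sub_eq_of_sum_eq_zero D.virtualSign D.sum_virtualSign
  have := Fintype.ofFinite D.LongArc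
  let f : D.C0 := fun v => -S v.1
  refine ⟨D.virtualIndexCocycle + D.coboundary f,
    (D.cohomologyClass_eq_indexClass_iff _).2 ⟨f, rfl⟩, fun a => ?_⟩
  -- Testing against the indicator of one arc turns the claim into a sum over the whole curve.
  let ψ : D.LongArc → ℤ := Pi.single a 1
  have e : ∀ g : D.LongArc → ℤ, ∑ b, ψ b * g b = g a := fun g => by simp [ψ, Pi.single_apply]
  have h1 := D.sum_mul_virtualIndexOnArcs ψ
  have h2 := D.sum_mul_coboundary ψ f
  rw [e] at h1
  rw [e fun b => D.coboundary f (Sum.inl b)] at h2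
  -- The sum extends to all points: at a nonclassical point the arc does not change, and at a
  -- classical one `S p = S (p - 1)`.
  have h3 : ∑ v : D.GaussVertex, (ψ (D.arcOf (v.1 - 1)) - ψ (D.arcOf v.1)) * f v =
      ∑ p, (ψ (D.arcOf (p - 1)) - ψ (D.arcOf p)) * -S (p - 1) := by
    have h4 : ∀ p, p ∉ Finset.univ.filter (fun p => D.IsClassical p) →
        (ψ (D.arcOf (p - 1)) - ψ (D.arcOf p)) * -S (p - 1) = 0 := fun p hp => by
      rw [D.arcOf_sub_one (by simpa using hp), sub_self, zero_mul]
    rw [← Finset.sum_subset (Finset.subset_univ _) fun p _ hp => h4 p hp]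
    rw [Finset.sum_subtype (p := fun p => D.IsClassical p) _ (by simp)]
    refine Finset.sum_congr rfl fun v _ => ?_
    have := hS v.1
    rw [D.virtualSign_of_isClassical v.2, sub_eq_zero] at this
    simp only [f, this]
  have h5 : ∑ p, ψ (D.arcOf (p - 1)) * S (p - 1) = ∑ p, ψ (D.arcOf p) * S p :=
    Equiv.sum_comp (Equiv.subRight (1 : ZMod n)) fun p => ψ (D.arcOf p) * S p
  have h6 : (D.virtualIndexCocycle + D.coboundary f) (Sum.inl a) =
      D.virtualIndexOnArcs a + D.coboundary f (Sum.inl a) := rfl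
  rw [h6, h1, h2, h3, ← sub_eq_zero.2 h5.symm, ← Finset.sum_sub_distrib, ← Finset.sum_add_distrib,
    ← sub_eq_zero, ← Finset.sum_sub_distrib]
  refine Finset.sum_eq_zero fun p _ => ?_
  rw [← hS]
  ring

end VirtualKnotDiagram

theorem mainTheorem7 (n : ℕ) [NeZero n] (D : VirtualKnotDiagram n) :
    (∃! i : D.C1, D.cohomologyClass i = D.indexClass ∧ ∀ a : D.LongArc, i (Sum.inl a) = 0) ∧
    ∀ i : D.C1, D.cohomologyClass i = D.indexClass → (∀ a : D.LongArc, i (Sum.inl a) = 0) →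
      ∀ c : D.Chord, i (Sum.inr c) = D.index c := by
  refine ⟨?_, fun i hi h0 c => D.eq_index_of_indexClass hi h0 c⟩
  obtain ⟨i, hi, h0⟩ := D.exists_indexClass_eq_and_vanish
  refine ⟨i, ⟨hi, h0⟩, fun j ⟨hj, hj0⟩ => ?_⟩
  funext e
  cases e with
  | inl a => rw [h0, hj0]
  | inr c => rw [D.eq_index_of_indexClass hi h0, D.eq_index_of_indexClass hj hj0]
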